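/- Let $n\ge 1$ be an integer, $\mu_X,\mu_Y\in\mathbb{R}$, $\sigma_X,\sigma_Y>0$ and $\rho\in(-1,1)$. Let $(X,Y)$ be a bivariate normal random vector with means $\mu_X,\mu_Y$, variances $\sigma_X^2,\sigma_Y^2$ and correlation coefficient $\rho$, let $Z_1,\ldots,Z_n$ be independent copies of the product $Z=XY$, and let $\overline{Z}_n=n^{-1}\sum_{i=1}^nZ_i$. Write $r_X=\mu_X/\sigma_X$, $r_Y=\mu_Y/\sigma_Y$ and $s_n=\sigma_X\sigma_Y/n$, and for $f\in C^4(\mathbb{R})$ define \begin{align*} A_1f(x)&=s_n^4(1-\rho^2)^2xf^{(4)}(x)+s_n^3(1-\rho^2)\big(ns_n(1-\rho^2)+4\rho x\big)f^{(3)}(x)\\ &\quad+s_n^2\big(ns_n(\rho(r_X^2+r_Y^2)-(1+\rho^2)r_Xr_Y+3\rho(1-\rho^2))+(6\rho^2-2)x\big)f''(x)\\ &\quad+s_n\big(ns_n(2\rho r_Xr_Y-r_X^2-r_Y^2+3\rho^2-1)-4\rho x\big)f'(x)\\ &\quad+\big(x-\mu_X\mu_Y-ns_n\rho\big)f(x).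 \end{align*} Let $W$ be a real-valued random variable such that $\mathbb{E}|W|<\infty$. Then $W$ has the same distribution as $\overline{Z}_n$ if and only if $$\mathbb{E}[A_1f(W)]=0$$ (that is, the expectation exists and is equal to $0$) for all $f:\mathbb{R}\to\mathbb{R}$ such that $f\in C^4(\mathbb{R})$ and such that $\mathbb{E}|f^{(m)}(\overline{Z}_n)|$, for $m=0,1,2,3$, and $\mathbb{E}|\overline{Z}_nf^{(m)}(\overline{Z}_n)|$, for $m=0,1,2,3,4$, are finite, where $f^{(0)}\equiv f$. -/

import Mathlib

open MeasureTheory ProbabilityTheory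

noncomputable section

/-- The covariance matrix of a bivariate normal vector `(X, Y)` with standard deviations `σX`, `σY`
and correlation coefficient `ρ`. It is positive definite when `0 < σX`, `0 < σY`, `-1 < ρ < 1`. -/
def bivariateCov (σX σY ρ : ℝ) : Matrix (Fin 2) (Fin 2) ℝ :=
  !![σX ^ 2, ρ * σX * σY; ρ * σX * σY, σY ^ 2]

/-- The law of `(X, Y)`, bivariate normal with means `μX`, `μY`, variances `σX ^ 2`, `σY ^ 2` and
correlation coefficient `ρ`. -/
def bivariateNormal (μX μY σX σY ρ : ℝ) : Measure (EuclideanSpace ℝ (Fin 2)) :=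
  multivariateGaussian !₂[μX, μY] (bivariateCov σX σY ρ)

/-- The law of the product `Z = X Y` of the two coordinates of a bivariate normal vector. -/
def productNormal (μX μY σX σY ρ : ℝ) : Measure ℝ :=
  (bivariateNormal μX μY σX σY ρ).map (fun p => p 0 * p 1)

/-- The fourth order operator `A₁`, with `s = σX σY / n`, `rX = μX / σX` and `rY = μY / σY`. -/
def steinA1 (n : ℕ) (μX μY σX σY ρ : ℝ) (f : ℝ → ℝ) (x : ℝ) : ℝ :=
  let s : ℝ := σX * σY / n
  let rX : ℝ := μX / σX
  let rY : ℝ := μY / σY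
  s ^ 4 * (1 - ρ ^ 2) ^ 2 * x * iteratedDeriv 4 f x
    + s ^ 3 * (1 - ρ ^ 2) * (n * s * (1 - ρ ^ 2) + 4 * ρ * x) * iteratedDeriv 3 f x
    + s ^ 2 * (n * s * (ρ * (rX ^ 2 + rY ^ 2) - (1 + ρ ^ 2) * rX * rY + 3 * ρ * (1 - ρ ^ 2))
        + (6 * ρ ^ 2 - 2) * x) * iteratedDeriv 2 f x
    + s * (n * s * (2 * ρ * rX * rY - rX ^ 2 - rY ^ 2 + 3 * ρ ^ 2 - 1)
        - 4 * ρ * x) * iteratedDeriv 1 f x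
    + (x - μX * μY - n * s * ρ) * f x

/-- The sample mean `(Z₁ + ⋯ + Zₙ) / n`. -/
def sampleMean {Ω : Type*} {n : ℕ} (Z : Fin n → Ω → ℝ) (ω : Ω) : ℝ :=
  (∑ i, Z i ω) / n

end

/-!
The proof goes through characteristic functions. The coefficients of `steinA1` are affine in `x`,
so applying it to `x ↦ exp (i t x)` and taking expectations under a law with a first moment and
characteristic function `φ` gives a first order linear expression `p(t) φ(t) - i q(t) φ'(t)`, with
polynomials `p` and `q` (`integral_symbol_mul_cexp`).

The law of the sample mean makes this expression vanish. Indeed `X / σX + Y / σY` and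
`X / σX - Y / σY` are independent normal variables and `X Y` is `σX σY / 4` times the difference of
their squares (`productNormal_eq_map_prod`), so the logarithmic derivative of the characteristic
function of `X Y` is an explicit rational function (`hasDerivAt_charFun_productNormal`), and so is
that of the sample mean; its denominator is `q` (`integral_steinSymbol_sampleMean`).

If `W` satisfies the Stein identity, the test functions `cos (t x)` and `sin (t x)` show that its
characteristic function solves the same equation (`integral_symbol_eq_zero_of_forall`). As `q` has no
real zero because `-1 < ρ < 1`, the solution with value `1` at `0` is unique
(`eq_of_integral_symbol_eq_zero`).

Conversely, if the expectation of the operator vanishes on exponentials, it vanishes on smooth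
compactly supported functions by Fourier inversion and Fubini's theorem
(`integral_affineDiffOp_eq_zero_of_smooth`), then on compactly supported `C⁴` functions by
mollification, and finally on every `C⁴` function with the stated moments by a cutoff
(`integral_affineDiffOp_eq_zero`).
-/

noncomputable section

open Filter Topology Finset
open scoped ContDiff FourierTransform

/-! ### The characteristic function of the product of two normal variables -/

open Complex in
/-- The coefficient of `x ^ 2` in the exponent of `exp (i s x²)` times a Gaussian density of
variance `v` has negative real part, which makes the integral over `ℝ` converge. -/
lemma re_mul_I_sub_inv_two_mul_neg {v : NNReal} (hv : v ≠ 0) (s : ℝ) :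
    (s * I - (2 * (v : ℂ))⁻¹).re < 0 := by
  have hv0 : (0 : ℝ) < v := by positivity
  have hv2 : ((2 * (v : ℂ))⁻¹) = (((2 * (v : ℝ))⁻¹ : ℝ) : ℂ) := by push_cast; rfl
  have hpos : 0 < (2 * (v : ℝ))⁻¹ := by positivity
  rw [hv2]
  simp only [sub_re, mul_re, ofReal_re, ofReal_im, I_re, I_im]
  linarith

open Complex in
lemma mul_I_sub_inv_two_mul_ne_zero {v : NNReal} (hv : v ≠ 0) (s : ℝ) :
    (s * I - (2 * (v : ℂ))⁻¹) ≠ 0 := by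
  intro h
  have := re_mul_I_sub_inv_two_mul_neg hv s
  rw [h] at this
  exact lt_irrefl 0 this

open Complex in
/-- The characteristic function of the square of a normal variable. -/
lemma integral_cexp_sq_gaussianReal (m : ℝ) {v : NNReal} (hv : v ≠ 0) (s : ℝ) :
    ∫ x, cexp (s * (x : ℂ) ^ 2 * I) ∂gaussianReal m v =
      ((Real.sqrt (2 * Real.pi * v))⁻¹ : ℝ) *
        ((Real.pi / -(s * I - (2 * (v : ℂ))⁻¹)) ^ (1 / 2 : ℂ) *
          cexp (-(m ^ 2 / (2 * v)) - (m / v) ^ 2 / (4 * (s * I - (2 * (v : ℂ))⁻¹)))) := by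
  have hv0 : (0 : ℝ) < v := by positivity
  have hvC : (v : ℂ) ≠ 0 := by exact_mod_cast hv0.ne'
  rw [integral_gaussianReal_eq_integral_smul hv, ← integral_cexp_quadratic,
    ← integral_const_mul]
  · refine integral_congr_ae (Filter.Eventually.of_forall fun x => ?_)
    simp only [gaussianPDFReal, real_smul]
    push_cast
    rw [mul_assoc, ← Complex.exp_add]
    congr 2
    field_simp
    ring
  · exact re_mul_I_sub_inv_two_mul_neg hv s

open Complex in
lemma integral_cexp_sq_gaussianReal_ne_zero (m : ℝ) {v : NNReal} (hv : v ≠ 0) (s : ℝ) :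
    ∫ x, cexp (s * (x : ℂ) ^ 2 * I) ∂gaussianReal m v ≠ 0 := by
  have hv0 : (0 : ℝ) < v := by positivity
  rw [integral_cexp_sq_gaussianReal m hv]
  refine mul_ne_zero ?_ (mul_ne_zero ?_ (exp_ne_zero _))
  · rw [ofReal_ne_zero]
    have := Real.pi_pos
    positivity
  · rw [cpow_ne_zero_iff_of_exponent_ne_zero (by norm_num)]
    exact div_ne_zero (by exact_mod_cast Real.pi_ne_zero)
      (neg_ne_zero.2 (mul_I_sub_inv_two_mul_ne_zero hv s))

open Complex in
/-- The characteristic function `ψ` of the square of an `N(m, v)` variable has logarithmic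
derivative `i v / (1 - 2 i s v) + i m² / (1 - 2 i s v)²`. -/
lemma hasDerivAt_integral_cexp_sq_gaussianReal (m : ℝ) {v : NNReal} (hv : v ≠ 0) (s : ℝ) :
    HasDerivAt (fun s : ℝ => ∫ x, cexp (s * (x : ℂ) ^ 2 * I) ∂gaussianReal m v)
      ((∫ x, cexp (s * (x : ℂ) ^ 2 * I) ∂gaussianReal m v) *
        (I * v / (1 - 2 * I * s * v) + I * m ^ 2 / (1 - 2 * I * s * v) ^ 2)) s := by
  have hv0 : (0 : ℝ) < v := by positivity
  have hvC : (v : ℂ) ≠ 0 := by exact_mod_cast hv0.ne'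
  have hb := mul_I_sub_inv_two_mul_ne_zero hv s
  have hslit : (Real.pi / -(s * I - (2 * (v : ℂ))⁻¹)) ∈ slitPlane := by
    left
    have hre : 0 < (-(s * I - (2 * (v : ℂ))⁻¹)).re := by
      rw [neg_re]
      linarith [re_mul_I_sub_inv_two_mul_neg hv s]
    rw [div_eq_mul_inv, re_ofReal_mul, inv_re]
    have := normSq_pos.2 (neg_ne_zero.2 hb)
    have := Real.pi_pos
    positivity
  simp_rw [integral_cexp_sq_gaussianReal m hv]
  have h1 : HasDerivAt (fun s : ℝ => s * I - (2 * (v : ℂ))⁻¹) I s := by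
    simpa using ((hasDerivAt_id s).ofReal_comp.mul_const I).sub_const ((2 * (v : ℂ))⁻¹)
  have h2 := (Complex.hasStrictDerivAt_cpow_const (c := 1 / 2) hslit).hasDerivAt.scomp s
    (HasDerivAt.fun_div (hasDerivAt_const s (Real.pi : ℂ)) h1.fun_neg (neg_ne_zero.2 hb))
  have h3 := ((HasDerivAt.fun_div (hasDerivAt_const s ((m / v : ℂ) ^ 2)) (h1.const_mul (4 : ℂ))
    (mul_ne_zero (by norm_num) hb)).const_sub (-(m ^ 2 / (2 * v) : ℂ))).cexp
  refine ((h2.fun_mul h3).const_mul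
    (((Real.sqrt (2 * Real.pi * v))⁻¹ : ℝ) : ℂ)).congr_deriv ?_
  simp only [Function.comp, smul_eq_mul]
  rw [cpow_sub _ _ (slitPlane_ne_zero hslit), cpow_one]
  set b := (s * I - (2 * (v : ℂ))⁻¹) with hbdef
  have hd : 1 - 2 * I * s * (v : ℂ) = -(2 * v * b) := by rw [hbdef]; field_simp; ring
  rw [hd]
  have hpi : (Real.pi : ℂ) ≠ 0 := by exact_mod_cast Real.pi_ne_zero
  generalize cexp _ = E
  generalize (_ : ℂ) ^ (1 / 2 : ℂ) = F
  field_simp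
  ring

lemma bivariateCov_posSemidef {σX σY ρ : ℝ} (hρ₁ : -1 < ρ) (hρ₂ : ρ < 1) :
    (bivariateCov σX σY ρ).PosSemidef := by
  refine Matrix.PosSemidef.of_dotProduct_mulVec_nonneg ?_ fun x => ?_
  · ext i j
    fin_cases i <;> fin_cases j <;> simp [bivariateCov]
  · simp [bivariateCov, Matrix.mulVec, dotProduct, Fin.sum_univ_two]
    nlinarith [sq_nonneg (σX * x 0 + σY * x 1), sq_nonneg (σX * x 0 - σY * x 1)]

lemma measurable_halfSum_halfDiff (σX σY : ℝ) : Measurable fun q : ℝ × ℝ =>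
    (!₂[σX * (q.1 + q.2) / 2, σY * (q.1 - q.2) / 2] : EuclideanSpace ℝ (Fin 2)) := by
  apply Continuous.measurable
  apply (PiLp.continuous_toLp 2 _).comp
  refine continuous_pi fun i => ?_
  fin_cases i <;> simp <;> fun_prop

/-- The sum and the difference of the standardised coordinates `X / σX`, `Y / σY` of a bivariate
normal vector are uncorrelated, hence independent, normal variables with variances `2 (1 + ρ)` and
`2 (1 - ρ)`; here the vector is recovered from them. -/
lemma bivariateNormal_eq_map_prod (μX μY : ℝ) {σX σY ρ : ℝ} (hσX : 0 < σX) (hσY : 0 < σY)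
    (hρ₁ : -1 < ρ) (hρ₂ : ρ < 1) :
    bivariateNormal μX μY σX σY ρ =
      ((gaussianReal (μX / σX + μY / σY) (2 * (1 + ρ)).toNNReal).prod
        (gaussianReal (μX / σX - μY / σY) (2 * (1 - ρ)).toNNReal)).map
        (fun q => !₂[σX * (q.1 + q.2) / 2, σY * (q.1 - q.2) / 2]) := by
  have hmeas := measurable_halfSum_halfDiff σX σY
  have := Measure.isProbabilityMeasure_map (μ := (gaussianReal (μX / σX + μY / σY)
    (2 * (1 + ρ)).toNNReal).prod (gaussianReal (μX / σX - μY / σY) (2 * (1 - ρ)).toNNReal))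
    hmeas.aemeasurable
  have : IsProbabilityMeasure (bivariateNormal μX μY σX σY ρ) := by
    unfold bivariateNormal; infer_instance
  refine Measure.ext_of_charFun (funext fun t => ?_)
  rw [bivariateNormal, charFun_multivariateGaussian (bivariateCov_posSemidef hρ₁ hρ₂),
    charFun_apply, integral_map hmeas.aemeasurable (by fun_prop)]
  have key : ∀ q : ℝ × ℝ, Complex.exp ((inner ℝ (!₂[σX * (q.1 + q.2) / 2, σY * (q.1 - q.2) / 2] :
      EuclideanSpace ℝ (Fin 2)) t : ℝ) * Complex.I) =
      Complex.exp (((σX * t 0 + σY * t 1) / 2 : ℝ) * q.1 * Complex.I) *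
        Complex.exp (((σX * t 0 - σY * t 1) / 2 : ℝ) * q.2 * Complex.I) := by
    intro q
    rw [← Complex.exp_add]
    congr 1
    simp [PiLp.inner_apply, Fin.sum_univ_two]
    ring
  simp_rw [key]
  rw [integral_prod_mul (fun x : ℝ => Complex.exp (((σX * t 0 + σY * t 1) / 2 : ℝ) * x * Complex.I))
    (fun x : ℝ => Complex.exp (((σX * t 0 - σY * t 1) / 2 : ℝ) * x * Complex.I)),
    ← charFun_apply_real, ← charFun_apply_real, charFun_gaussianReal, charFun_gaussianReal,
    ← Complex.exp_add, Real.coe_toNNReal _ (by linarith), Real.coe_toNNReal _ (by linarith)]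
  congr 1
  have hX : (σX : ℂ) ≠ 0 := by exact_mod_cast hσX.ne'
  have hY : (σY : ℂ) ≠ 0 := by exact_mod_cast hσY.ne'
  simp [PiLp.inner_apply, Fin.sum_univ_two, bivariateCov, Matrix.mulVec, dotProduct]
  field_simp
  ring

/-- By polarisation, `X Y` is a difference of squares of two independent normal variables. -/
lemma productNormal_eq_map_prod (μX μY : ℝ) {σX σY ρ : ℝ} (hσX : 0 < σX) (hσY : 0 < σY)
    (hρ₁ : -1 < ρ) (hρ₂ : ρ < 1) :
    productNormal μX μY σX σY ρ =
      ((gaussianReal (μX / σX + μY / σY) (2 * (1 + ρ)).toNNReal).prod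
        (gaussianReal (μX / σX - μY / σY) (2 * (1 - ρ)).toNNReal)).map
        (fun q => σX * σY / 4 * q.1 ^ 2 - σX * σY / 4 * q.2 ^ 2) := by
  have hmeas := measurable_halfSum_halfDiff σX σY
  rw [productNormal, bivariateNormal_eq_map_prod μX μY hσX hσY hρ₁ hρ₂,
    Measure.map_map (by fun_prop) hmeas]
  congr 1
  ext q
  simp
  ring

lemma integrable_id_productNormal (μX μY : ℝ) {σX σY ρ : ℝ} (hσX : 0 < σX) (hσY : 0 < σY)
    (hρ₁ : -1 < ρ) (hρ₂ : ρ < 1) :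
    Integrable (fun x : ℝ => x) (productNormal μX μY σX σY ρ) := by
  rw [productNormal_eq_map_prod μX μY hσX hσY hρ₁ hρ₂,
    integrable_map_measure (by fun_prop) (by fun_prop)]
  have h (m : ℝ) (v : NNReal) : Integrable (fun x : ℝ => x ^ 2) (gaussianReal m v) :=
    (memLp_id_gaussianReal 2).integrable_sq
  exact (((h _ _).comp_fst _).const_mul _).sub (((h _ _).comp_snd _).const_mul _)

open Complex in
lemma charFun_productNormal (μX μY : ℝ) {σX σY ρ : ℝ} (hσX : 0 < σX) (hσY : 0 < σY)
    (hρ₁ : -1 < ρ) (hρ₂ : ρ < 1) (t : ℝ) :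
    charFun (productNormal μX μY σX σY ρ) t =
      (∫ x, cexp ((σX * σY / 4 * t : ℝ) * (x : ℂ) ^ 2 * I)
        ∂gaussianReal (μX / σX + μY / σY) (2 * (1 + ρ)).toNNReal) *
      ∫ x, cexp ((-(σX * σY / 4 * t) : ℝ) * (x : ℂ) ^ 2 * I)
        ∂gaussianReal (μX / σX - μY / σY) (2 * (1 - ρ)).toNNReal := by
  rw [productNormal_eq_map_prod μX μY hσX hσY hρ₁ hρ₂, charFun_apply_real,
    integral_map (by fun_prop) (by fun_prop), ← integral_prod_mul]
  refine integral_congr_ae (Filter.Eventually.of_forall fun q => ?_)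
  beta_reduce
  rw [← Complex.exp_add]
  push_cast
  ring_nf

lemma charFun_productNormal_ne_zero (μX μY : ℝ) {σX σY ρ : ℝ} (hσX : 0 < σX) (hσY : 0 < σY)
    (hρ₁ : -1 < ρ) (hρ₂ : ρ < 1) (t : ℝ) :
    charFun (productNormal μX μY σX σY ρ) t ≠ 0 := by
  rw [charFun_productNormal μX μY hσX hσY hρ₁ hρ₂]
  exact mul_ne_zero (integral_cexp_sq_gaussianReal_ne_zero _ (by simp; linarith) _)
    (integral_cexp_sq_gaussianReal_ne_zero _ (by simp; linarith) _)

open Complex in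
lemma hasDerivAt_charFun_productNormal (μX μY : ℝ) {σX σY ρ : ℝ} (hσX : 0 < σX) (hσY : 0 < σY)
    (hρ₁ : -1 < ρ) (hρ₂ : ρ < 1) (t : ℝ) :
    HasDerivAt (charFun (productNormal μX μY σX σY ρ))
      (charFun (productNormal μX μY σX σY ρ) t * (σX * σY / 4 *
        ((I * (2 * (1 + ρ)) / (1 - I * (σX * σY * t) * (1 + ρ)) +
            I * (μX / σX + μY / σY) ^ 2 / (1 - I * (σX * σY * t) * (1 + ρ)) ^ 2) -
          (I * (2 * (1 - ρ)) / (1 + I * (σX * σY * t) * (1 - ρ)) +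
            I * (μX / σX - μY / σY) ^ 2 / (1 + I * (σX * σY * t) * (1 - ρ)) ^ 2)))) t := by
  have h1 := hasDerivAt_integral_cexp_sq_gaussianReal (μX / σX + μY / σY)
    (v := (2 * (1 + ρ)).toNNReal) (by simp; linarith) (σX * σY / 4 * t)
  have h2 := hasDerivAt_integral_cexp_sq_gaussianReal (μX / σX - μY / σY)
    (v := (2 * (1 - ρ)).toNNReal) (by simp; linarith) (-(σX * σY / 4 * t))
  have e : HasDerivAt (fun t : ℝ => σX * σY / 4 * t) (σX * σY / 4) t := by
    simpa using (hasDerivAt_id t).const_mul (σX * σY / 4)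
  have h := (h1.scomp t e).fun_mul (h2.scomp t e.fun_neg)
  rw [Real.coe_toNNReal (2 * (1 + ρ)) (by linarith),
    Real.coe_toNNReal (2 * (1 - ρ)) (by linarith)] at h
  rw [charFun_productNormal μX μY hσX hσY hρ₁ hρ₂,
    show charFun (productNormal μX μY σX σY ρ) = _ from
      funext (charFun_productNormal μX μY hσX hσY hρ₁ hρ₂)]
  refine h.congr_deriv ?_
  simp only [real_smul, Function.comp]
  push_cast
  rw [show (1 - 2 * I * (σX * σY / 4 * t) * (2 * (1 + ρ)) : ℂ) =
    1 - I * (σX * σY * t) * (1 + ρ) by ring, show (1 - 2 * I * (-(σX * σY / 4 * t)) *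
    (2 * (1 - ρ)) : ℂ) = 1 + I * (σX * σY * t) * (1 - ρ) by ring]
  ring

/-! ### Differential operators with affine coefficients -/

lemma ContinuousLinearMap.iteratedDeriv_comp {E F : Type*} [NormedAddCommGroup E] [NormedSpace ℝ E]
    [NormedAddCommGroup F] [NormedSpace ℝ F] (L : E →L[ℝ] F) {f : ℝ → E} {N : ℕ}
    (hf : ContDiff ℝ N f) {m : ℕ} (hm : m ≤ N) (x : ℝ) :
    iteratedDeriv m (fun y => L (f y)) x = L (iteratedDeriv m f x) := by
  have := L.iteratedFDeriv_comp_left (hf.contDiffAt (x := x)) (i := m) (by exact_mod_cast hm)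
  simp only [iteratedDeriv]
  change iteratedFDeriv ℝ m (L ∘ f) x _ = _
  rw [this]
  rfl

lemma HasCompactSupport.iteratedDeriv_real {E : Type*} [NormedAddCommGroup E] [NormedSpace ℝ E]
    {f : ℝ → E} (hc : HasCompactSupport f) (m : ℕ) : HasCompactSupport (iteratedDeriv m f) := by
  rw [iteratedDeriv_eq_equiv_comp]
  exact (hc.iteratedFDeriv (𝕜 := ℝ) m).comp_left (map_zero _)

/-- The differential operator `f ↦ ∑ m ≤ N, (a m + b m x) f⁽ᵐ⁾(x)` of order `N` whose coefficients
are affine functions of `x`. The values of `f` may be complex, so that it can be applied to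
exponentials. -/
def affineDiffOp {E : Type*} [NormedAddCommGroup E] [NormedSpace ℝ E] (N : ℕ) (a b : ℕ → ℝ)
    (f : ℝ → E) (x : ℝ) : E :=
  ∑ m ∈ range (N + 1), (a m + b m * x) • iteratedDeriv m f x

/-- The symbol of `affineDiffOp N a b`: the factor by which the operator multiplies the exponential
`x ↦ exp (i t x)`, see `affineDiffOp_cexp`. -/
def affineDiffOpSymbol (N : ℕ) (a b : ℕ → ℝ) (t x : ℝ) : ℂ :=
  ∑ m ∈ range (N + 1), ((a m + b m * x : ℝ) : ℂ) * (t * Complex.I) ^ m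

lemma affineDiffOp_clm_comp {E F : Type*} [NormedAddCommGroup E] [NormedSpace ℝ E]
    [NormedAddCommGroup F] [NormedSpace ℝ F] (L : E →L[ℝ] F) {f : ℝ → E} {N : ℕ}
    (hf : ContDiff ℝ N f) (a b : ℕ → ℝ) (x : ℝ) :
    affineDiffOp N a b (fun y => L (f y)) x = L (affineDiffOp N a b f x) := by
  simp only [affineDiffOp, map_sum, map_smul]
  refine sum_congr rfl fun m hm => ?_
  rw [L.iteratedDeriv_comp hf (by simpa [Nat.lt_succ_iff] using hm)]

lemma iteratedDeriv_cexp_mul_I (t : ℝ) (m : ℕ) :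
    iteratedDeriv m (fun x : ℝ => Complex.exp (t * x * Complex.I)) =
      fun x : ℝ => (t * Complex.I) ^ m * Complex.exp (t * x * Complex.I) := by
  induction m with
  | zero => simp
  | succ m ih =>
    rw [iteratedDeriv_succ, ih]
    ext x
    have h : HasDerivAt (fun x : ℝ => (t : ℂ) * x * Complex.I) (t * Complex.I) x := by
      simpa using ((hasDerivAt_id x).ofReal_comp.const_mul (t : ℂ)).mul_const Complex.I
    rw [(h.cexp.const_mul _).deriv]
    ring

lemma affineDiffOp_cexp (N : ℕ) (a b : ℕ → ℝ) (t x : ℝ) :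
    affineDiffOp N a b (fun x : ℝ => Complex.exp (t * x * Complex.I)) x =
      affineDiffOpSymbol N a b t x * Complex.exp (t * x * Complex.I) := by
  simp only [affineDiffOp, affineDiffOpSymbol, iteratedDeriv_cexp_mul_I, sum_mul,
    Complex.real_smul]
  exact sum_congr rfl fun m _ => by ring

lemma continuous_affineDiffOp {E : Type*} [NormedAddCommGroup E] [NormedSpace ℝ E] {N : ℕ}
    (a b : ℕ → ℝ) {f : ℝ → E} (hf : ContDiff ℝ N f) : Continuous (affineDiffOp N a b f) := by
  refine continuous_finsetSum _ fun m hm => ?_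
  exact (by fun_prop : Continuous fun x => a m + b m * x).smul
    (hf.continuous_iteratedDeriv m (by exact_mod_cast Nat.lt_succ_iff.1 (mem_range.1 hm)))

/-- The condition `a N = 0` is what allows the derivative of top order to be controlled only after
multiplication by `x`. -/
lemma integrable_affineDiffOp {ν : Measure ℝ} {N : ℕ} {a b : ℕ → ℝ} (ha : a N = 0) {f : ℝ → ℝ}
    (h₁ : ∀ m < N, Integrable (iteratedDeriv m f) ν)
    (h₂ : ∀ m ≤ N, Integrable (fun x => x * iteratedDeriv m f x) ν) :
    Integrable (affineDiffOp N a b f) ν := by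
  refine integrable_finsetSum _ fun m hm => ?_
  have hm' : m ≤ N := Nat.lt_succ_iff.1 (mem_range.1 hm)
  have h : Integrable (fun x => b m * (x * iteratedDeriv m f x)) ν := (h₂ m hm').const_mul _
  rcases hm'.lt_or_eq with hlt | rfl
  · refine (((h₁ m hlt).const_mul (a m)).add h).congr (.of_forall fun x => ?_)
    simp only [Pi.add_apply, smul_eq_mul]
    ring
  · refine h.congr (.of_forall fun x => ?_)
    simp only [ha, smul_eq_mul]
    ring

/-- Fourier inversion for the derivatives of a test function. -/
lemma iteratedDeriv_eq_integral_fourier {f : ℝ → ℂ} (hf : ContDiff ℝ ∞ f)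
    (hc : HasCompactSupport f) (m : ℕ) :
    Integrable (fun t : ℝ => ((2 * Real.pi * t : ℝ) * Complex.I) ^ m * 𝓕 f t) ∧
    ∀ x, iteratedDeriv m f x = ∫ t : ℝ, ((2 * Real.pi * t : ℝ) * Complex.I) ^ m * 𝓕 f t *
      Complex.exp ((2 * Real.pi * t : ℝ) * x * Complex.I) := by
  have hcm := hc.iteratedDeriv_real
  have hdm (m : ℕ) : ContDiff ℝ ∞ (iteratedDeriv m f) := by
    rw [iteratedDeriv_eq_iterate]
    exact hf.iterate_deriv m
  let g : SchwartzMap ℝ ℂ := (hcm m).toSchwartzMap (hdm m)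
  have hg : (g : ℝ → ℂ) = iteratedDeriv m f := rfl
  have hF : 𝓕 (iteratedDeriv m f) =
      fun t : ℝ => ((2 * Real.pi * t : ℝ) * Complex.I) ^ m * 𝓕 f t := by
    rw [Real.fourier_iteratedDeriv (N := ⊤) hf (fun k _ =>
      (hdm k).continuous.integrable_of_hasCompactSupport (hcm k)) le_top]
    ext t
    rw [smul_eq_mul]
    push_cast
    ring_nf
  have hint : Integrable (𝓕 (iteratedDeriv m f)) := by
    rw [← hg, ← SchwartzMap.fourier_coe]
    exact (𝓕 g).integrable
  refine ⟨hF ▸ hint, fun x => ?_⟩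
  have hinv := (hdm m).continuous.fourierInv_fourier_eq
    ((hdm m).continuous.integrable_of_hasCompactSupport (hcm m)) hint
  conv_lhs => rw [← hinv]
  rw [Real.fourierInv_eq', hF]
  refine integral_congr_ae (.of_forall fun t => ?_)
  simp only [smul_eq_mul, RCLike.inner_apply, conj_trivial]
  rw [mul_comm]
  congr 2
  push_cast
  ring

/-- An identity that holds for all exponentials holds for all test functions, by Fourier inversion
and Fubini's theorem. -/
lemma integral_affineDiffOp_eq_zero_of_smooth {ν : Measure ℝ} [IsFiniteMeasure ν]
    (hν : Integrable (fun x : ℝ => x) ν) {N : ℕ} {a b : ℕ → ℝ}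
    (hsymb : ∀ t : ℝ, ∫ x, affineDiffOpSymbol N a b t x * Complex.exp (t * x * Complex.I) ∂ν = 0)
    {f : ℝ → ℂ} (hf : ContDiff ℝ ∞ f) (hc : HasCompactSupport f) :
    ∫ x, affineDiffOp N a b f x ∂ν = 0 := by
  have hinv := iteratedDeriv_eq_integral_fourier hf hc
  have hterm (x : ℝ) (m : ℕ) : Integrable (fun t : ℝ => ((a m + b m * x : ℝ) : ℂ) *
      (((2 * Real.pi * t : ℝ) * Complex.I) ^ m * 𝓕 f t *
        Complex.exp ((2 * Real.pi * t : ℝ) * x * Complex.I))) := by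
    refine Integrable.const_mul ?_ _
    refine (hinv m).1.mul_bdd (c := 1)
      (g := fun t : ℝ => Complex.exp ((2 * Real.pi * t : ℝ) * x * Complex.I))
      (by fun_prop) (.of_forall fun t => ?_)
    rw [← Complex.ofReal_mul, Complex.norm_exp_ofReal_mul_I]
  have hrep (x : ℝ) : affineDiffOp N a b f x = ∫ t : ℝ,
      ∑ m ∈ range (N + 1), ((a m + b m * x : ℝ) : ℂ) *
      (((2 * Real.pi * t : ℝ) * Complex.I) ^ m * 𝓕 f t *
        Complex.exp ((2 * Real.pi * t : ℝ) * x * Complex.I)) := by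
    rw [integral_finsetSum _ fun m _ => hterm x m]
    refine sum_congr rfl fun m _ => ?_
    rw [integral_const_mul, (hinv m).2 x, Complex.real_smul]
  simp_rw [hrep]
  rw [integral_integral_swap]
  · rw [← integral_zero ℝ ℂ (μ := volume)]
    refine integral_congr_ae (.of_forall fun t => ?_)
    beta_reduce
    have : ∀ x : ℝ, ∑ m ∈ range (N + 1), ((a m + b m * x : ℝ) : ℂ) *
      (((2 * Real.pi * t : ℝ) * Complex.I) ^ m * 𝓕 f t *
        Complex.exp ((2 * Real.pi * t : ℝ) * x * Complex.I)) = 𝓕 f t *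
        (affineDiffOpSymbol N a b (2 * Real.pi * t) x *
          Complex.exp ((2 * Real.pi * t : ℝ) * x * Complex.I)) := fun x => by
      rw [affineDiffOpSymbol, sum_mul, mul_sum]
      exact sum_congr rfl fun m _ => by ring
    simp_rw [this]
    rw [integral_const_mul, hsymb, mul_zero]
  · refine integrable_finsetSum _ fun m _ => ?_
    have h1 : Integrable (fun x : ℝ => ((a m + b m * x : ℝ) : ℂ)) ν :=
      ((integrable_const (a m)).add (hν.const_mul (b m))).ofReal
    refine ((h1.mul_prod (hinv m).1).mul_bdd (c := 1) (g := fun p : ℝ × ℝ => Complex.exp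
      ((2 * Real.pi * p.2 : ℝ) * p.1 * Complex.I)) (by fun_prop)
      (.of_forall fun t => ?_)).congr (.of_forall fun p => ?_)
    · rw [← Complex.ofReal_mul, Complex.norm_exp_ofReal_mul_I]
    · beta_reduce
      ring

/-! ### From exponentials to general test functions -/

lemma iteratedDeriv_normed_convolution (φ : ContDiffBump (0 : ℝ)) {N : ℕ} {f : ℝ → ℝ}
    (hf : ContDiff ℝ N f) (hc : HasCompactSupport f) {m : ℕ} (hm : m ≤ N) :
    iteratedDeriv m (convolution (φ.normed volume) f (ContinuousLinearMap.lsmul ℝ ℝ) volume) =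
      convolution (φ.normed volume) (iteratedDeriv m f) (ContinuousLinearMap.lsmul ℝ ℝ) volume := by
  induction m with
  | zero => simp
  | succ m ih =>
    rw [iteratedDeriv_succ, ih (by omega)]
    ext x
    have h1 : ContDiff ℝ 1 (iteratedDeriv m f) := by
      rw [iteratedDeriv_eq_iterate]
      exact ContDiff.iterate_deriv' 1 m (hf.of_le (by exact_mod_cast (by omega : 1 + m ≤ N)))
    rw [(HasCompactSupport.hasDerivAt_convolution_right (ContinuousLinearMap.lsmul ℝ ℝ)
      φ.continuous_normed.locallyIntegrable (hc.iteratedDeriv_real m) h1 x).deriv, iteratedDeriv_succ]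

lemma norm_normed_convolution_le (φ : ContDiffBump (0 : ℝ)) {h : ℝ → ℝ} {C : ℝ}
    (hC : ∀ x, ‖h x‖ ≤ C) (x : ℝ) :
    ‖convolution (φ.normed volume) h (ContinuousLinearMap.lsmul ℝ ℝ) volume x‖ ≤ C := by
  have := norm_integral_le_of_norm_le (μ := volume) (φ.integrable_normed.mul_const C)
    (f := fun t => φ.normed volume t • h (x - t)) (.of_forall fun t => by
      rw [norm_smul, Real.norm_of_nonneg (φ.nonneg_normed t)]
      exact mul_le_mul_of_nonneg_left (hC _) (φ.nonneg_normed t))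
  rwa [integral_mul_const, φ.integral_normed, one_mul] at this

lemma norm_affineDiffOp_le {E : Type*} [NormedAddCommGroup E] [NormedSpace ℝ E] (N : ℕ)
    (a b : ℕ → ℝ) (f : ℝ → E) (x : ℝ) :
    ‖affineDiffOp N a b f x‖ ≤
      ∑ m ∈ range (N + 1), (|a m| + |b m| * |x|) * ‖iteratedDeriv m f x‖ := by
  refine norm_sum_le_of_le _ fun m _ => ?_
  rw [norm_smul, Real.norm_eq_abs, ← abs_mul]
  gcongr
  exact abs_add_le _ _

/-- Reduction of the compactly supported `C^N` case to the smooth one: mollification converges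
boundedly together with all derivatives of order at most `N`. -/
lemma integral_affineDiffOp_eq_zero_of_hasCompactSupport {ν : Measure ℝ} [IsFiniteMeasure ν]
    (hν : Integrable (fun x : ℝ => x) ν) {N : ℕ} {a b : ℕ → ℝ}
    (hsymb : ∀ t : ℝ, ∫ x, affineDiffOpSymbol N a b t x * Complex.exp (t * x * Complex.I) ∂ν = 0)
    {f : ℝ → ℝ} (hf : ContDiff ℝ N f) (hc : HasCompactSupport f) :
    ∫ x, affineDiffOp N a b f x ∂ν = 0 := by
  let φ (k : ℕ) : ContDiffBump (0 : ℝ) :=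
    ⟨1 / (k + 1 : ℝ) / 2, 1 / (k + 1 : ℝ), by positivity, half_lt_self (by positivity)⟩
  let g (k : ℕ) : ℝ → ℝ :=
    convolution ((φ k).normed volume) f (ContinuousLinearMap.lsmul ℝ ℝ) volume
  have hg (k : ℕ) : ContDiff ℝ ∞ (g k) :=
    (φ k).hasCompactSupport_normed.contDiff_convolution_left _ (φ k).contDiff_normed
      (hf.continuous.locallyIntegrable)
  have hgc (k : ℕ) : HasCompactSupport (g k) := (φ k).hasCompactSupport_normed.convolution _ hc
  have hzero (k : ℕ) : ∫ x, affineDiffOp N a b (g k) x ∂ν = 0 := by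
    have h := integral_affineDiffOp_eq_zero_of_smooth hν hsymb
      (f := fun x => Complex.ofRealCLM (g k x)) (Complex.ofRealCLM.contDiff.comp (hg k))
      ((hgc k).comp_left (g := Complex.ofRealCLM) (map_zero _))
    simp_rw [affineDiffOp_clm_comp Complex.ofRealCLM ((hg k).of_le (mod_cast le_top)) a b,
      Complex.ofRealCLM_apply] at h
    rw [integral_complex_ofReal] at h
    exact_mod_cast h
  have hbd : ∀ m, ∃ C, m ≤ N → ∀ x, ‖iteratedDeriv m f x‖ ≤ C := fun m => by
    by_cases hm : m ≤ N
    · obtain ⟨C, hC⟩ := (hf.continuous_iteratedDeriv m (mod_cast hm)).bounded_above_of_compact_support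
        (hc.iteratedDeriv_real m)
      exact ⟨C, fun _ => hC⟩
    · exact ⟨0, fun h => absurd h hm⟩
  choose C hC using hbd
  have hlim : Tendsto (fun k => ∫ x, affineDiffOp N a b (g k) x ∂ν) atTop
      (𝓝 (∫ x, affineDiffOp N a b f x ∂ν)) := by
    refine tendsto_integral_of_dominated_convergence
      (fun x => ∑ m ∈ range (N + 1), (|a m| + |b m| * |x|) * C m)
      (fun k => (continuous_affineDiffOp a b
        ((hg k).of_le (mod_cast le_top))).aestronglyMeasurable) ?_ ?_ ?_
    · exact integrable_finsetSum _ fun m _ =>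
        ((integrable_const _).add (hν.abs.const_mul _)).mul_const _
    · refine fun k => .of_forall fun x => (norm_affineDiffOp_le N a b (g k) x).trans ?_
      refine sum_le_sum fun m hm => ?_
      have hm' : m ≤ N := Nat.lt_succ_iff.1 (mem_range.1 hm)
      rw [iteratedDeriv_normed_convolution (φ k) hf hc hm']
      gcongr
      exact norm_normed_convolution_le _ (hC m hm') x
    · refine .of_forall fun x => tendsto_finsetSum _ fun m hm => ?_
      have hm' : m ≤ N := Nat.lt_succ_iff.1 (mem_range.1 hm)
      refine Tendsto.const_smul ?_ _
      simp_rw [g, iteratedDeriv_normed_convolution (φ _) hf hc hm']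
      exact ContDiffBump.convolution_tendsto_right_of_continuous
        tendsto_one_div_add_atTop_nhds_zero_nat (hf.continuous_iteratedDeriv m (mod_cast hm')) x
  simp_rw [hzero] at hlim
  exact (tendsto_nhds_unique hlim tendsto_const_nhds)

/-- If the integral of `affineDiffOp N a b` vanishes on all exponentials, then it vanishes on every
`C^N` function for which it can be expected to converge. Such a function is approximated by its
products with the cutoffs `χ (x / (k + 1))`, whose derivatives are bounded uniformly in `k`, so that
by Leibniz' rule the derivatives of `f` themselves provide the dominating function. -/
theorem integral_affineDiffOp_eq_zero {ν : Measure ℝ} [IsFiniteMeasure ν]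
    (hν : Integrable (fun x : ℝ => x) ν) {N : ℕ} {a b : ℕ → ℝ} (ha : a N = 0)
    (hsymb : ∀ t : ℝ, ∫ x, affineDiffOpSymbol N a b t x * Complex.exp (t * x * Complex.I) ∂ν = 0)
    {f : ℝ → ℝ} (hf : ContDiff ℝ N f)
    (h₁ : ∀ m < N, Integrable (iteratedDeriv m f) ν)
    (h₂ : ∀ m ≤ N, Integrable (fun x => x * iteratedDeriv m f x) ν) :
    ∫ x, affineDiffOp N a b f x ∂ν = 0 := by
  let χ : ContDiffBump (0 : ℝ) := ⟨1, 2, one_pos, one_lt_two⟩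
  have hχ : ContDiff ℝ ∞ χ := χ.contDiff
  have hχN : ContDiff ℝ N χ := hχ.of_le (mod_cast le_top)
  have hbd : ∀ m, ∃ C, ∀ x, ‖iteratedDeriv m χ x‖ ≤ C := fun m =>
    (hχ.continuous_iteratedDeriv m (mod_cast le_top)).bounded_above_of_compact_support
      (χ.hasCompactSupport.iteratedDeriv_real m)
  choose C hC using hbd
  let ψ (k : ℕ) (x : ℝ) : ℝ := χ ((1 / (k + 1 : ℝ)) * x)
  have hψ (k : ℕ) : ContDiff ℝ N (ψ k) := hχN.comp (contDiff_const.mul contDiff_id)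
  have hψC (k m : ℕ) (x : ℝ) : ‖iteratedDeriv m (ψ k) x‖ ≤ C m := by
    simp only [ψ, iteratedDeriv_comp_const_mul (hχ.of_le (mod_cast le_top) : ContDiff ℝ m χ)]
    rw [norm_mul, norm_pow]
    refine (mul_le_of_le_one_left (norm_nonneg _) (pow_le_one₀ (norm_nonneg _) ?_)).trans (hC m _)
    rw [Real.norm_of_nonneg (by positivity), div_le_one (by positivity)]
    linarith [(Nat.cast_nonneg k : (0 : ℝ) ≤ k)]
  let g (k : ℕ) : ℝ → ℝ := ψ k * f
  have hg (k : ℕ) : ContDiff ℝ N (g k) := (hψ k).mul hf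
  have hzero (k : ℕ) : ∫ x, affineDiffOp N a b (g k) x ∂ν = 0 := by
    refine integral_affineDiffOp_eq_zero_of_hasCompactSupport hν hsymb (hg k) ?_
    refine HasCompactSupport.mul_right ?_
    exact χ.hasCompactSupport.comp_homeomorph
      (Homeomorph.mulLeft₀ (1 / (k + 1 : ℝ)) (by positivity))
  have hgd (k : ℕ) {m : ℕ} (hm : m ≤ N) (x : ℝ) : ‖iteratedDeriv m (g k) x‖ ≤
      ∑ i ∈ range (m + 1), m.choose i * C i * ‖iteratedDeriv (m - i) f x‖ := by
    rw [iteratedDeriv_mul ((hψ k).of_le (mod_cast hm)).contDiffAt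
      (hf.of_le (mod_cast hm)).contDiffAt]
    refine norm_sum_le_of_le _ fun i _ => ?_
    rw [norm_mul, norm_mul, Real.norm_natCast]
    gcongr
    exact hψC k i x
  have hlim : Tendsto (fun k => ∫ x, affineDiffOp N a b (g k) x ∂ν) atTop
      (𝓝 (∫ x, affineDiffOp N a b f x ∂ν)) := by
    refine tendsto_integral_of_dominated_convergence
      (fun x => ∑ m ∈ range (N + 1), (|a m| + |b m| * |x|) *
        ∑ i ∈ range (m + 1), m.choose i * C i * ‖iteratedDeriv (m - i) f x‖)
      (fun k => (continuous_affineDiffOp a b (hg k)).aestronglyMeasurable) ?_ ?_ ?_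
    · refine integrable_finsetSum _ fun m hm => ?_
      have hm' : m ≤ N := Nat.lt_succ_iff.1 (mem_range.1 hm)
      simp_rw [mul_sum]
      refine integrable_finsetSum _ fun i hi => ?_
      have hb : Integrable (fun x => |b m| * (m.choose i * C i) *
          ‖x * iteratedDeriv (m - i) f x‖) ν := (h₂ (m - i) (by omega)).norm.const_mul _
      have ha' : Integrable (fun x => |a m| * (m.choose i * C i) *
          ‖iteratedDeriv (m - i) f x‖) ν := by
        rcases hm'.lt_or_eq with hlt | rfl
        · exact (h₁ (m - i) (by omega)).norm.const_mul _
        · simp [ha]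
      refine (ha'.add hb).congr (.of_forall fun x => ?_)
      simp only [Pi.add_apply, norm_mul, Real.norm_eq_abs]
      ring
    · refine fun k => .of_forall fun x => (norm_affineDiffOp_le N a b (g k) x).trans ?_
      refine sum_le_sum fun m hm => ?_
      gcongr
      exact hgd k (Nat.lt_succ_iff.1 (mem_range.1 hm)) x
    · -- Near a fixed point the cutoff equals `1` as soon as `k` is large.
      refine .of_forall fun x => tendsto_const_nhds.congr' ?_
      obtain ⟨K, hK⟩ := exists_nat_gt |x|
      filter_upwards [eventually_ge_atTop K] with k hk
      have hKk : (K : ℝ) ≤ k := by exact_mod_cast hk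
      have hev : g k =ᶠ[𝓝 x] f := by
        have : ∀ᶠ y in 𝓝 x, |y| < (k + 1 : ℝ) :=
          continuous_abs.continuousAt.eventually_lt_const (by linarith)
        filter_upwards [this] with y hy
        have : ψ k y = 1 := by
          refine χ.one_of_mem_closedBall ?_
          rw [mem_closedBall_zero_iff, norm_mul, Real.norm_of_nonneg (by positivity),
            one_div, inv_mul_le_iff₀ (by positivity)]
          simpa [χ] using hy.le
        simp [g, this]
      exact sum_congr rfl fun m _ => by rw [hev.iteratedDeriv_eq m]
  simp_rw [hzero] at hlim
  exact (tendsto_nhds_unique hlim tendsto_const_nhds)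

/-! ### The differential equation for the characteristic function -/

lemma integrable_mul_cexp {ν : Measure ℝ} (hν : Integrable (fun x : ℝ => x) ν) (t : ℝ) :
    Integrable (fun x : ℝ => (x : ℂ) * Complex.exp (t * x * Complex.I)) ν := by
  refine (hν.ofReal (𝕜 := ℂ)).mul_bdd (c := 1)
    (g := fun x : ℝ => Complex.exp (t * x * Complex.I)) (by fun_prop) (.of_forall fun x => ?_)
  rw [← Complex.ofReal_mul, Complex.norm_exp_ofReal_mul_I]

lemma integrable_cexp {ν : Measure ℝ} [IsFiniteMeasure ν] (t : ℝ) :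
    Integrable (fun x : ℝ => Complex.exp (t * x * Complex.I)) ν := by
  refine Integrable.of_bound (by fun_prop) 1 (.of_forall fun x => ?_)
  rw [← Complex.ofReal_mul, Complex.norm_exp_ofReal_mul_I]

lemma affineDiffOpSymbol_eq (N : ℕ) (a b : ℕ → ℝ) (t x : ℝ) :
    affineDiffOpSymbol N a b t x = ∑ m ∈ range (N + 1), a m * (t * Complex.I) ^ m +
      x * ∑ m ∈ range (N + 1), b m * (t * Complex.I) ^ m := by
  rw [affineDiffOpSymbol, mul_sum, ← sum_add_distrib]
  refine sum_congr rfl fun m _ => ?_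
  push_cast
  ring

lemma integrable_symbol_mul_cexp {ν : Measure ℝ} [IsFiniteMeasure ν]
    (hν : Integrable (fun x : ℝ => x) ν) (N : ℕ) (a b : ℕ → ℝ) (t : ℝ) :
    Integrable (fun x => affineDiffOpSymbol N a b t x * Complex.exp (t * x * Complex.I)) ν := by
  simp_rw [affineDiffOpSymbol_eq, add_mul, mul_right_comm _ _ (Complex.exp _)]
  exact ((integrable_cexp t).const_mul _).add ((integrable_mul_cexp hν t).mul_const _)

lemma hasDerivAt_charFun {ν : Measure ℝ} [IsFiniteMeasure ν]
    (hν : Integrable (fun x : ℝ => x) ν) (t : ℝ) :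
    HasDerivAt (charFun ν) (Complex.I * ∫ x, x * Complex.exp (t * x * Complex.I) ∂ν) t := by
  have hmem : MemLp id (1 : ℕ) ν := by
    rw [Nat.cast_one, memLp_one_iff_integrable]
    exact hν
  have h := ((contDiff_charFun hmem).differentiable one_ne_zero t).hasDerivAt
  have h2 := iteratedDeriv_charFun (t := t) hmem
  rw [iteratedDeriv_one] at h2
  rw [h2] at h
  simpa using h

/-- Integrating the exponentials turns the operator into a first order linear differential
expression in the characteristic function. -/
lemma integral_symbol_mul_cexp {ν : Measure ℝ} [IsFiniteMeasure ν]
    (hν : Integrable (fun x : ℝ => x) ν) (N : ℕ) (a b : ℕ → ℝ) (t : ℝ) :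
    ∫ x, affineDiffOpSymbol N a b t x * Complex.exp (t * x * Complex.I) ∂ν =
      (∑ m ∈ range (N + 1), a m * (t * Complex.I) ^ m) * charFun ν t -
        Complex.I * (∑ m ∈ range (N + 1), b m * (t * Complex.I) ^ m) * deriv (charFun ν) t := by
  simp_rw [affineDiffOpSymbol_eq, add_mul, mul_right_comm _ _ (Complex.exp _)]
  rw [integral_add ((integrable_cexp t).const_mul _) ((integrable_mul_cexp hν t).mul_const _),
    integral_const_mul, integral_mul_const, (hasDerivAt_charFun hν t).deriv, charFun_apply_real]
  linear_combination ((∑ m ∈ range (N + 1), (b m : ℂ) * (t * Complex.I) ^ m) *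
    ∫ x, (x : ℂ) * Complex.exp (t * x * Complex.I) ∂ν) * Complex.I_sq

/-- The test functions used are the real and imaginary parts of `x ↦ exp (i t x)`. -/
lemma integral_symbol_eq_zero_of_forall {ν : Measure ℝ} [IsFiniteMeasure ν]
    (hν : Integrable (fun x : ℝ => x) ν) {N : ℕ} {a b : ℕ → ℝ}
    (h : ∀ f : ℝ → ℝ, ContDiff ℝ N f → (∀ m ≤ N, ∃ C, ∀ x, ‖iteratedDeriv m f x‖ ≤ C) →
      ∫ x, affineDiffOp N a b f x ∂ν = 0) (t : ℝ) :
    ∫ x, affineDiffOpSymbol N a b t x * Complex.exp (t * x * Complex.I) ∂ν = 0 := by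
  set e : ℝ → ℂ := fun x => Complex.exp (t * x * Complex.I) with he
  have hed : ContDiff ℝ N e := by
    rw [he]
    exact ((contDiff_const.mul Complex.ofRealCLM.contDiff).mul contDiff_const).cexp
  have hint : Integrable (affineDiffOp N a b e) ν :=
    (integrable_symbol_mul_cexp hν N a b t).congr
      (.of_forall fun x => (affineDiffOp_cexp N a b t x).symm)
  have hL (L : ℂ →L[ℝ] ℝ) : L (∫ x, affineDiffOp N a b e x ∂ν) = 0 := by
    rw [← L.integral_comp_comm hint]
    simp_rw [← affineDiffOp_clm_comp L hed]
    refine h _ (L.contDiff.comp hed) fun m hm => ⟨‖L‖ * |t| ^ m, fun x => ?_⟩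
    rw [L.iteratedDeriv_comp hed hm]
    refine L.le_of_opNorm_le_of_le le_rfl ?_
    rw [he, iteratedDeriv_cexp_mul_I, norm_mul, ← Complex.ofReal_mul,
      Complex.norm_exp_ofReal_mul_I]
    simp
  simp_rw [← affineDiffOp_cexp]
  exact Complex.ext (hL Complex.reCLM) (hL Complex.imCLM)

/-- Uniqueness for the first order linear differential equation satisfied by the characteristic
function: the quotient of two solutions is constant. -/
lemma eq_of_integral_symbol_eq_zero {μ ν : Measure ℝ} [IsProbabilityMeasure μ]
    [IsProbabilityMeasure ν] (hμ : Integrable (fun x : ℝ => x) μ)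
    (hν : Integrable (fun x : ℝ => x) ν) {N : ℕ} {a b : ℕ → ℝ}
    (hb : ∀ t : ℝ, ∑ m ∈ range (N + 1), (b m : ℂ) * (t * Complex.I) ^ m ≠ 0)
    (h0 : ∀ t, charFun ν t ≠ 0)
    (hsμ : ∀ t : ℝ, ∫ x, affineDiffOpSymbol N a b t x * Complex.exp (t * x * Complex.I) ∂μ = 0)
    (hsν : ∀ t : ℝ, ∫ x, affineDiffOpSymbol N a b t x * Complex.exp (t * x * Complex.I) ∂ν = 0) :
    μ = ν := by
  have hd (t : ℝ) : HasDerivAt (fun s => charFun μ s / charFun ν s) 0 t := by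
    have h1 := (hasDerivAt_charFun hμ t).differentiableAt.hasDerivAt
    have h2 := (hasDerivAt_charFun hν t).differentiableAt.hasDerivAt
    refine (h1.fun_div h2 (h0 t)).congr_deriv ?_
    have e1 := hsμ t
    have e2 := hsν t
    rw [integral_symbol_mul_cexp hμ] at e1
    rw [integral_symbol_mul_cexp hν] at e2
    rw [div_eq_zero_iff]
    left
    refine (mul_eq_zero.1 (?_ : (Complex.I * ∑ m ∈ range (N + 1), (b m : ℂ) *
      (t * Complex.I) ^ m) * _ = 0)).resolve_left (mul_ne_zero Complex.I_ne_zero (hb t))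
    linear_combination -charFun ν t * e1 + charFun μ t * e2
  refine Measure.ext_of_charFun (funext fun t => ?_)
  have hc := is_const_of_deriv_eq_zero (fun t => (hd t).differentiableAt)
    (fun t => (hd t).deriv) t 0
  simp only [charFun_zero, probReal_univ, Complex.ofReal_one, div_one] at hc
  rwa [div_eq_one_iff_eq (h0 t)] at hc

/-! ### The sample mean -/

section SampleMean

variable {n : ℕ} {Ω : Type*} [MeasurableSpace Ω] {P : Measure Ω}
  {Z : Fin n → Ω → ℝ}

lemma aemeasurable_sampleMean (hZ : ∀ i, AEMeasurable (Z i) P) :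
    AEMeasurable (sampleMean Z) P :=
  (Finset.aemeasurable_fun_sum _ fun i _ => hZ i).div_const _

lemma integrable_sampleMean (hZ : ∀ i, Integrable (Z i) P) :
    Integrable (sampleMean Z) P :=
  (integrable_finsetSum _ fun i _ => hZ i).div_const _

lemma charFun_map_sampleMean [IsProbabilityMeasure P] {κ : Measure ℝ} (hZind : iIndepFun Z P)
    (hZlaw : ∀ i, HasLaw (Z i) κ P) (t : ℝ) :
    charFun (P.map (sampleMean Z)) t = charFun κ (t / n) ^ n := by
  have hZ i := (hZlaw i).aemeasurable
  have : sampleMean Z = fun w => (n : ℝ)⁻¹ * ∑ i, Z i w := by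
    ext w; rw [sampleMean, div_eq_inv_mul]
  rw [this, charFun_map_mul_comp (Finset.aemeasurable_fun_sum _ fun i _ => hZ i),
    hZind.charFun_map_fun_sum_eq_prod hZ]
  simp [(hZlaw _).map_eq, div_eq_inv_mul]

end SampleMean

/-! ### The symbol of the Stein operator -/

/-- The constant terms of the coefficients of `steinA1`: its coefficient of `f⁽ᵐ⁾(x)` is
`steinConst m + steinSlope m * x`. -/
def steinConst (n : ℕ) (μX μY σX σY ρ : ℝ) : ℕ → ℝ
  | 0 => -(μX * μY) - n * (σX * σY / n) * ρ
  | 1 => (σX * σY / n) * (n * (σX * σY / n) *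
      (2 * ρ * (μX / σX) * (μY / σY) - (μX / σX) ^ 2 - (μY / σY) ^ 2 + 3 * ρ ^ 2 - 1))
  | 2 => (σX * σY / n) ^ 2 * (n * (σX * σY / n) * (ρ * ((μX / σX) ^ 2 + (μY / σY) ^ 2) -
      (1 + ρ ^ 2) * (μX / σX) * (μY / σY) + 3 * ρ * (1 - ρ ^ 2)))
  | 3 => (σX * σY / n) ^ 3 * (1 - ρ ^ 2) * (n * (σX * σY / n) * (1 - ρ ^ 2))
  | _ => 0

/-- The factors of `x` in the coefficients of `steinA1`. -/
def steinSlope (n : ℕ) (σX σY ρ : ℝ) : ℕ → ℝ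
  | 0 => 1
  | 1 => -(4 * ρ * (σX * σY / n))
  | 2 => (σX * σY / n) ^ 2 * (6 * ρ ^ 2 - 2)
  | 3 => (σX * σY / n) ^ 3 * (1 - ρ ^ 2) * (4 * ρ)
  | 4 => (σX * σY / n) ^ 4 * (1 - ρ ^ 2) ^ 2
  | _ => 0

lemma steinA1_eq_affineDiffOp (n : ℕ) (μX μY σX σY ρ : ℝ) (f : ℝ → ℝ) (x : ℝ) :
    steinA1 n μX μY σX σY ρ f x =
      affineDiffOp 4 (steinConst n μX μY σX σY ρ) (steinSlope n σX σY ρ) f x := by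
  simp only [steinA1, affineDiffOp, sum_range_succ, range_zero, sum_empty, steinConst, steinSlope,
    smul_eq_mul, iteratedDeriv_zero]
  ring

/-- The leading coefficient of the differential equation for the characteristic function is the
common denominator in `hasDerivAt_charFun_productNormal`. -/
lemma sum_steinSlope (n : ℕ) (σX σY ρ t : ℝ) :
    ∑ m ∈ range 5, (steinSlope n σX σY ρ m : ℂ) * (t * Complex.I) ^ m =
      ((1 - Complex.I * (σX * σY * (t / n)) * (1 + ρ)) *
        (1 + Complex.I * (σX * σY * (t / n)) * (1 - ρ))) ^ 2 := by
  simp only [sum_range_succ, range_zero, sum_empty, steinSlope]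
  push_cast
  ring

lemma one_add_I_mul_ne_zero (x : ℝ) : 1 + Complex.I * x ≠ 0 := by
  intro h
  simpa using congrArg Complex.re h

lemma sum_steinSlope_ne_zero (n : ℕ) (σX σY ρ t : ℝ) :
    ∑ m ∈ range 5, (steinSlope n σX σY ρ m : ℂ) * (t * Complex.I) ^ m ≠ 0 := by
  rw [sum_steinSlope]
  have h1 := one_add_I_mul_ne_zero (-(σX * σY * (t / n) * (1 + ρ)))
  have h2 := one_add_I_mul_ne_zero (σX * σY * (t / n) * (1 - ρ))
  push_cast at h1 h2
  refine pow_ne_zero _ (mul_ne_zero ?_ ?_)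
  · convert h1 using 1
    ring
  · convert h2 using 1
    ring

/-- With `A` and `B` the two denominators in `hasDerivAt_charFun_productNormal` at `t / n`, the
zeroth order coefficient of the differential equation is, up to a factor `i`, the numerator of that
logarithmic derivative over the common denominator `(A B)²`. -/
lemma sum_steinConst {n : ℕ} (hn : n ≠ 0) (μX μY : ℝ) {σX σY : ℝ} (hσX : σX ≠ 0) (hσY : σY ≠ 0)
    (ρ t : ℝ) {A B : ℂ} (hA : A = 1 - Complex.I * (σX * σY * (t / n)) * (1 + ρ))
    (hB : B = 1 + Complex.I * (σX * σY * (t / n)) * (1 - ρ)) :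
    ∑ m ∈ range 5, (steinConst n μX μY σX σY ρ m : ℂ) * (t * Complex.I) ^ m =
      -(σX * σY / 4) * ((2 * (1 + ρ) * A * B ^ 2 + (μX / σX + μY / σY) ^ 2 * B ^ 2) -
        (2 * (1 - ρ) * A ^ 2 * B + (μX / σX - μY / σY) ^ 2 * A ^ 2)) := by
  obtain ⟨x, rfl⟩ : ∃ x, μX = σX * x := ⟨μX / σX, by field_simp⟩
  obtain ⟨y, rfl⟩ : ∃ y, μY = σY * y := ⟨μY / σY, by field_simp⟩
  have hX : (σX : ℂ) ≠ 0 := by exact_mod_cast hσX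
  have hY : (σY : ℂ) ≠ 0 := by exact_mod_cast hσY
  simp only [sum_range_succ, range_zero, sum_empty, steinConst, hA, hB]
  rw [mul_div_cancel_left₀ _ hσX, mul_div_cancel_left₀ _ hσY,
    mul_div_cancel₀ (σX * σY) (by exact_mod_cast hn : (n : ℝ) ≠ 0)]
  push_cast
  rw [mul_div_cancel_left₀ _ hX, mul_div_cancel_left₀ _ hY]
  ring

/-- The characteristic function of the sample mean solves the first order equation attached to
`steinA1`. -/
lemma integral_steinSymbol_sampleMean {n : ℕ} (hn : 1 ≤ n) {μX μY σX σY ρ : ℝ} (hσX : 0 < σX)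
    (hσY : 0 < σY) (hρ₁ : -1 < ρ) (hρ₂ : ρ < 1) {Ω : Type*} [MeasurableSpace Ω] {P : Measure Ω}
    [IsProbabilityMeasure P] {Z : Fin n → Ω → ℝ} (hZind : iIndepFun Z P)
    (hZlaw : ∀ i, HasLaw (Z i) (productNormal μX μY σX σY ρ) P)
    (hint : Integrable (fun x : ℝ => x) (P.map (sampleMean Z))) (t : ℝ) :
    ∫ x, affineDiffOpSymbol 4 (steinConst n μX μY σX σY ρ) (steinSlope n σX σY ρ) t x *
      Complex.exp (t * x * Complex.I) ∂(P.map (sampleMean Z)) = 0 := by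
  have hn0 : (n : ℂ) ≠ 0 := by exact_mod_cast (by omega : n ≠ 0)
  rw [integral_symbol_mul_cexp hint]
  have hφ : charFun (P.map (sampleMean Z)) =
      fun t => charFun (productNormal μX μY σX σY ρ) (t / n) ^ n :=
    funext (charFun_map_sampleMean hZind hZlaw)
  have hdiv : HasDerivAt (fun t : ℝ => t / n) (1 / n) t := by
    simpa using (hasDerivAt_id t).div_const (n : ℝ)
  have hd := ((hasDerivAt_charFun_productNormal μX μY hσX hσY hρ₁ hρ₂ (t / n)).scomp t hdiv).fun_pow n
  rw [hφ]
  simp only [Function.comp_def] at hd ⊢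
  rw [hd.deriv, sum_steinSlope]
  set φ := charFun (productNormal μX μY σX σY ρ) (t / n)
  have hpow : φ ^ n = φ ^ (n - 1) * φ := by rw [← pow_succ, Nat.sub_add_cancel hn]
  rw [hpow, Complex.real_smul]
  generalize φ ^ (n - 1) = ψ
  have h1 := one_add_I_mul_ne_zero (-(σX * σY * (t / n) * (1 + ρ)))
  have h2 := one_add_I_mul_ne_zero (σX * σY * (t / n) * (1 - ρ))
  have hX : (σX : ℂ) ≠ 0 := by exact_mod_cast hσX.ne'
  have hY : (σY : ℂ) ≠ 0 := by exact_mod_cast hσY.ne'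
  push_cast at h1 h2 ⊢
  set A : ℂ := 1 - Complex.I * (σX * σY * (t / n)) * (1 + ρ) with hA
  set B : ℂ := 1 + Complex.I * (σX * σY * (t / n)) * (1 - ρ) with hB
  have hA0 : A ≠ 0 := by
    convert h1 using 1
    rw [hA]
    ring
  have hB0 : B ≠ 0 := by
    convert h2 using 1
    rw [hB]
    ring
  rw [sum_steinConst (by omega) μX μY hσX.ne' hσY.ne' ρ t hA hB]
  generalize (μX / σX + μY / σY : ℂ) = x
  generalize (μX / σX - μY / σY : ℂ) = y
  clear_value A B
  field_simp
  linear_combination σX * σY * ψ * φ * (2 * (1 - ρ) * A ^ 2 * B - 2 * (1 + ρ) * A * B ^ 2 -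
    B ^ 2 * x ^ 2 + A ^ 2 * y ^ 2) * Complex.I_sq

end

/-! ### The Stein characterisation -/

theorem theorem2p1
    (n : ℕ) (hn : 1 ≤ n)
    (μX μY σX σY ρ : ℝ) (hσX : 0 < σX) (hσY : 0 < σY) (hρ₁ : -1 < ρ) (hρ₂ : ρ < 1)
    {Ω : Type*} [MeasurableSpace Ω] (P : Measure Ω) [IsProbabilityMeasure P]
    (Z : Fin n → Ω → ℝ) (hZind : iIndepFun Z P)
    (hZlaw : ∀ i, HasLaw (Z i) (productNormal μX μY σX σY ρ) P)
    {Ω' : Type*} [MeasurableSpace Ω'] (P' : Measure Ω') [IsProbabilityMeasure P']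
    (W : Ω' → ℝ) (hW : Integrable W P') :
    IdentDistrib W (sampleMean Z) P' P ↔
      ∀ f : ℝ → ℝ, ContDiff ℝ 4 f →
        (∀ m : ℕ, m ≤ 3 → Integrable (fun ω => iteratedDeriv m f (sampleMean Z ω)) P) →
        (∀ m : ℕ, m ≤ 4 →
          Integrable (fun ω => sampleMean Z ω * iteratedDeriv m f (sampleMean Z ω)) P) →
        Integrable (fun ω => steinA1 n μX μY σX σY ρ f (W ω)) P' ∧
          ∫ ω, steinA1 n μX μY σX σY ρ f (W ω) ∂P' = 0 := by
  have hS : AEMeasurable (sampleMean Z) P :=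
    aemeasurable_sampleMean fun i => (hZlaw i).aemeasurable
  have hZint (i : Fin n) : Integrable (Z i) P := by
    have h := integrable_id_productNormal μX μY hσX hσY hρ₁ hρ₂
    rw [← (hZlaw i).map_eq] at h
    exact (integrable_map_measure (by fun_prop) (hZlaw i).aemeasurable).1 h
  have hSint : Integrable (sampleMean Z) P := integrable_sampleMean hZint
  have hν : Integrable (fun x : ℝ => x) (P.map (sampleMean Z)) :=
    (integrable_map_measure (by fun_prop) hS).2 hSint
  have hμ : Integrable (fun x : ℝ => x) (P'.map W) :=
    (integrable_map_measure (by fun_prop) hW.aemeasurable).2 hW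
  have : IsProbabilityMeasure (P.map (sampleMean Z)) := Measure.isProbabilityMeasure_map hS
  have : IsProbabilityMeasure (P'.map W) := Measure.isProbabilityMeasure_map hW.aemeasurable
  have hsν := integral_steinSymbol_sampleMean hn hσX hσY hρ₁ hρ₂ hZind hZlaw hν
  simp_rw [steinA1_eq_affineDiffOp]
  constructor
  · intro hid f hf h₁ h₂
    have hcont := continuous_affineDiffOp (steinConst n μX μY σX σY ρ) (steinSlope n σX σY ρ) hf
    have h₁' (m : ℕ) (hm : m < 4) : Integrable (iteratedDeriv m f) (P.map (sampleMean Z)) :=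
      (integrable_map_measure (hf.continuous_iteratedDeriv m
        (by exact_mod_cast hm.le)).aestronglyMeasurable hS).2 (h₁ m (by omega))
    have h₂' (m : ℕ) (hm : m ≤ 4) :
        Integrable (fun x => x * iteratedDeriv m f x) (P.map (sampleMean Z)) :=
      (integrable_map_measure (continuous_id.mul (hf.continuous_iteratedDeriv m
        (by exact_mod_cast hm))).aestronglyMeasurable hS).2 (h₂ m hm)
    -- The coefficient of the fourth derivative has no constant term, whence `rfl`.
    have hA := integrable_affineDiffOp (a := steinConst n μX μY σX σY ρ)
      (b := steinSlope n σX σY ρ) rfl h₁' h₂'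
    have hA0 := integral_affineDiffOp_eq_zero hν rfl hsν hf h₁' h₂'
    rw [← hid.map_eq] at hA hA0
    rw [integral_map hW.aemeasurable hcont.aestronglyMeasurable] at hA0
    exact ⟨(integrable_map_measure hcont.aestronglyMeasurable hW.aemeasurable).1 hA, hA0⟩
  · intro h
    refine ⟨hW.aemeasurable, hS, ?_⟩
    refine eq_of_integral_symbol_eq_zero hμ hν (sum_steinSlope_ne_zero n σX σY ρ) (fun t => ?_)
      (integral_symbol_eq_zero_of_forall hμ fun f hf hbd => ?_) hsν
    · rw [charFun_map_sampleMean hZind hZlaw]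
      exact pow_ne_zero _ (charFun_productNormal_ne_zero μX μY hσX hσY hρ₁ hρ₂ _)
    · have hmeas (m : ℕ) (hm : m ≤ 4) :
          AEStronglyMeasurable (fun w => iteratedDeriv m f (sampleMean Z w)) P :=
        ((hf.continuous_iteratedDeriv m (by exact_mod_cast hm)).measurable.comp_aemeasurable
          hS).aestronglyMeasurable
      rw [integral_map hW.aemeasurable (continuous_affineDiffOp _ _ hf).aestronglyMeasurable]
      refine (h f hf (fun m hm => ?_) fun m hm => ?_).2
      · obtain ⟨C, hC⟩ := hbd m (by omega)
        exact Integrable.of_bound (hmeas m (by omega)) C (.of_forall fun w => hC _)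
      · obtain ⟨C, hC⟩ := hbd m hm
        exact hSint.mul_bdd (hmeas m hm) (.of_forall fun w => hC _)
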